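/- Let $m,n\ge 1$. Let $\mathfrak S_n^m$ be the group of colored permutations, i.e. pairs $(w,x)$ with $w\in\mathfrak S_n$ a permutation of $\{1,\dots,n\}$ and $x\in(\mathbb Z/m\mathbb Z)^n$, with multiplication $$(u,x)(v,y)=(uv,\,z),\qquad z_i=x_{v(i)}+y_i .$$ For $a\in\mathbb Z/m\mathbb Z$ let $|a|\in\{0,\dots,m-1\}$ be its representative. The $i$-th colored letter of $g=(w,x)$ is the value $w(i)$ with color $|x_i|$. Colored letters are totally ordered so that a letter with smaller color is larger than every letter with larger color, and letters of equal color are compared by their values. The major index $\operatorname{maj}(g)$ is the sum of all $i\in\{1,\dots,n-1\}$ such that the $i$-th colored letter of $g$ is larger than the $(i+1)$-st, and $\operatorname{col}(g)=\sum_{i=1}^n|x_i|$. Then, for all elements $p,q$ of any commutative ring (in particular, for indeterminates $p,q$), $$\det\left(p^{\operatorname{maj}(gh^{-1})}q^{\operatorname{col}(gh^{-1})}\right)_{g,h\in\mathfrak S_n^m}=\prod_{k=2}^n(1-p^k)^{n!\,m^n(k-1)/k}\;\prod_{k=1}^n(1-q^{mk})^{n!\,m^{n-1}(m-1)/k}.$$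 -/

import Mathlib

open scoped Nat

/-- A colored permutation `(w, x)`: a permutation `w` of `n` letters (indexed by `Fin n`, so that
`i : Fin n` stands for the position or value `i + 1`) and a color vector `x ∈ (ℤ/mℤ)ⁿ`. -/
@[ext]
structure ColoredPerm (n m : ℕ) where
  perm : Equiv.Perm (Fin n)
  color : Fin n → ZMod m

namespace ColoredPerm

variable {n m : ℕ}

/-- The semidirect product law `(u, x) (v, y) = (u v, x · v + y)`, where `(x · v)ᵢ = x_{v(i)}`. -/
instance : Mul (ColoredPerm n m) :=
  ⟨fun g h => ⟨g.perm * h.perm, fun i => g.color (h.perm i) + h.color i⟩⟩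

instance : One (ColoredPerm n m) := ⟨⟨1, 0⟩⟩

instance : Inv (ColoredPerm n m) :=
  ⟨fun g => ⟨g.perm⁻¹, fun i => -g.color (g.perm⁻¹ i)⟩⟩

@[simp] theorem mul_perm (g h : ColoredPerm n m) : (g * h).perm = g.perm * h.perm := rfl

@[simp] theorem mul_color (g h : ColoredPerm n m) (i : Fin n) :
    (g * h).color i = g.color (h.perm i) + h.color i := rfl

@[simp] theorem one_perm : (1 : ColoredPerm n m).perm = 1 := rfl

@[simp] theorem one_color (i : Fin n) : (1 : ColoredPerm n m).color i = 0 := rfl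

@[simp] theorem inv_perm (g : ColoredPerm n m) : g⁻¹.perm = g.perm⁻¹ := rfl

@[simp] theorem inv_color (g : ColoredPerm n m) (i : Fin n) :
    g⁻¹.color i = -g.color (g.perm⁻¹ i) := rfl

/-- The group `𝔖ₙᵐ` of colored permutations. -/
instance : Group (ColoredPerm n m) :=
  Group.ofLeftAxioms
    (fun a b c => by ext i <;> simp [mul_assoc, add_assoc])
    (fun a => by ext i <;> simp)
    (fun a => by ext i <;> simp)

/-- A colored permutation is a pair. -/
def equivProd (n m : ℕ) : ColoredPerm n m ≃ Equiv.Perm (Fin n) × (Fin n → ZMod m) where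
  toFun g := (g.perm, g.color)
  invFun a := ⟨a.1, a.2⟩
  left_inv _ := rfl
  right_inv _ := rfl

instance : DecidableEq (ColoredPerm n m) := (equivProd n m).decidableEq

instance [NeZero m] : Fintype (ColoredPerm n m) := Fintype.ofEquiv _ (equivProd n m).symm

/-- The `i`-th colored letter of the one-line notation: the value `w(i)` with `|xᵢ|` bars, where
`|xᵢ| ∈ {0, …, m - 1}` represents `xᵢ`. The lexicographic order compares the number of bars first
(more bars is smaller), then the values:
`n > ⋯ > 1 > n̄ > ⋯ > 1̄ > n̿ > ⋯`. -/
def letter (g : ColoredPerm n m) (i : Fin n) : ℕᵒᵈ ×ₗ Fin n :=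
  toLex (OrderDual.toDual (g.color i).val, g.perm i)

/-- The descents: positions `i + 1 ≤ n - 1` (with `i` counted from `0`) whose letter exceeds the
next one. -/
def descents (g : ColoredPerm n m) : Finset (Fin n) :=
  {i | ∃ h : (i : ℕ) + 1 < n, g.letter ⟨i + 1, h⟩ < g.letter i}

/-- The major index: the sum of the descents, as positions counted from `1`. -/
def maj (g : ColoredPerm n m) : ℕ := ∑ i ∈ g.descents, ((i : ℕ) + 1)

/-- The color sum, with colors represented in `{0, …, m - 1}`. -/
def col (g : ColoredPerm n m) : ℕ := ∑ i, (g.color i).val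

end ColoredPerm

/-! The matrix is that of left multiplication by `∑ p ^ maj g * q ^ col g • g` on the group ring, so
a factorization of this element factors the determinant. Sorting the letters writes each `g`
uniquely as `s * u`, with `s` increasing and `u` uncolored; `col` sees only `s` and `maj` only `u`
(`sum_maj_col_eq_mul`).

Both factors reduce to one statistic, `fmaj = m * maj + col`. The element `rotate`, of order `m * (n
+ 1)`, gives a unique factorization `rotate ^ k * extend h` on which `fmaj` is `k + fmaj h`; hence
`det_fmaj` by induction, each step contributing a geometric sum in a cyclic group. The case `m = 1`
evaluates the uncolored factor. The increasing factor does not involve `p`, so it is found by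
setting `p = q ^ m` and dividing in `ℤ[X]`. -/

/-! ### Determinants of group ring elements. -/

section RegularMatrix

variable {G H R : Type*} [Group G] [Fintype G] [DecidableEq G] [Group H] [Fintype H]
  [DecidableEq H] [CommRing R]

variable (R) in
/-- The permutation matrix of left multiplication by a group element. -/
def regularMatrix : G →* Matrix G G R where
  toFun a := Matrix.of fun g h => if g = a * h then 1 else 0
  map_one' := by
    ext g h
    simp [Matrix.one_apply]
  map_mul' a b := by
    ext g h
    simp [Matrix.mul_apply, mul_assoc]

theorem regularMatrix_apply (a g h : G) :
    regularMatrix R a g h = if g = a * h then 1 else 0 := rfl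

theorem sum_smul_regularMatrix_apply {ι : Type*} [Fintype ι] (c : ι → R) (a : ι → G) (g h : G) :
    (∑ i, c i • regularMatrix R (a i)) g h = ∑ i, if g = a i * h then c i else 0 := by
  simp [Matrix.sum_apply, regularMatrix_apply]

theorem of_mul_inv_eq_sum_smul_regularMatrix (c : G → R) :
    (Matrix.of fun g h : G => c (g * h⁻¹)) = ∑ a, c a • regularMatrix R a := by
  ext g h
  rw [sum_smul_regularMatrix_apply, Finset.sum_eq_single (g * h⁻¹)]
  · simp
  · intro b _ hb
    rw [if_neg]
    rintro rfl
    simp at hb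
  · simp

/-- Left multiplication by the image of `H` preserves each of its `k` right cosets, and acts on each
as on `H` itself. -/
theorem det_sum_smul_regularMatrix_map {ι : Type*} [Fintype ι] (f : H →* G)
    (hf : Function.Injective f) {k : ℕ} (hk : Fintype.card G = Fintype.card H * k)
    (c : ι → R) (a : ι → H) :
    (∑ i, c i • regularMatrix R (f (a i))).det = (∑ i, c i • regularMatrix R (a i)).det ^ k := by
  classical
  obtain ⟨T, hT, -⟩ := f.range.exists_isComplement_right 1
  let e : H × T ≃ G :=
    ((MonoidHom.ofInjective hf).toEquiv.prodCongr (Equiv.refl T)).trans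
      (Equiv.ofBijective _ hT)
  have he : ∀ x, e x = f x.1 * x.2 := fun x => rfl
  have hmul : ∀ (b : H) (x : H × T), f b * e x = e (b * x.1, x.2) := by
    intro b x
    simp [he, mul_assoc]
  have hcard : Fintype.card T = k := by
    have h := Fintype.card_congr e
    rw [Fintype.card_prod, hk] at h
    exact Nat.eq_of_mul_eq_mul_left Fintype.card_pos h
  have hblock : (∑ i, c i • regularMatrix R (f (a i))).submatrix e e =
      Matrix.blockDiagonal fun _ : T => ∑ i, c i • regularMatrix R (a i) := by
    ext ⟨x, s⟩ ⟨y, t⟩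
    rw [Matrix.submatrix_apply, sum_smul_regularMatrix_apply, Matrix.blockDiagonal_apply]
    simp only [hmul, e.apply_eq_iff_eq, Prod.mk.injEq, sum_smul_regularMatrix_apply]
    split_ifs with h <;> simp [h]
  rw [← Matrix.det_submatrix_equiv_self e, hblock, Matrix.det_blockDiagonal, Finset.prod_const,
    Finset.card_univ, hcard]

theorem det_one_sub_cyclic (q : R) (k : ℕ) :
    (Matrix.of fun i j : Fin (k + 1) =>
      (if i = j then (1 : R) else 0) - q * (if i = j + 1 then 1 else 0)).det = 1 - q ^ (k + 1) := by
  set A := Matrix.of fun i j : Fin (k + 1) =>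
      (if i = j then (1 : R) else 0) - q * (if i = j + 1 then 1 else 0)
  -- `B` inverts `A` without its wrap-around entry, so `A * B` differs from the identity only in row
  -- `0`.
  let B : Matrix (Fin (k + 1)) (Fin (k + 1)) R :=
    Matrix.of fun i j => if j ≤ i then q ^ ((i : ℕ) - j) else 0
  have hB : B.det = 1 := by
    rw [Matrix.det_of_isLowerTriangular]
    · simp [B]
    · intro i j hij
      exact if_neg (not_le.2 hij)
  have hAB : ∀ i j, (A * B) i j = B i j - q * B (i - 1) j := by
    intro i j
    have h : ∀ l : Fin (k + 1), i = l + 1 ↔ l = i - 1 := fun l =>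
      ⟨fun h => by simp [h], fun h => by simp [h]⟩
    simp [A, Matrix.mul_apply, sub_mul, Finset.sum_sub_distrib, h]
  have hsucc : ∀ (i : Fin k) (j : Fin (k + 1)),
      (A * B) i.succ j = if i.succ = j then 1 else 0 := by
    intro i j
    have h1 : i.succ - 1 = i.castSucc := by
      rw [sub_eq_iff_eq_add, Fin.coeSucc_eq_succ]
    rw [hAB, h1]
    simp only [B, Matrix.of_apply]
    rcases lt_trichotomy i.succ j with h | h | h
    · rw [if_neg (not_le.2 h), if_neg (not_le.2 (i.castSucc_lt_succ.trans h)), if_neg h.ne]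
      simp
    · rw [if_pos h.ge, if_neg (not_le.2 (h ▸ i.castSucc_lt_succ)), if_pos h, h]
      simp
    · have h' : j ≤ i.castSucc := Fin.le_castSucc_iff.2 h
      rw [if_pos h.le, if_pos h', if_neg h.ne', ← pow_succ', sub_eq_zero]
      congr 1
      have := Fin.le_def.1 h'
      simp only [Fin.val_succ, Fin.val_castSucc] at this ⊢
      omega
  have hzero : (A * B) 0 0 = 1 - q ^ (k + 1) := by
    rw [hAB]
    have : (0 : Fin (k + 1)) - 1 = Fin.last k := by
      rw [sub_eq_iff_eq_add, Fin.last_add_one]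
    simp [B, this, pow_succ']
  have hdet : (A * B).det = 1 - q ^ (k + 1) := by
    rw [Matrix.det_of_isUpperTriangular, Fin.prod_univ_succ, hzero]
    · simp [hsucc]
    · intro i j hij
      obtain ⟨i, rfl⟩ := Fin.exists_succ_eq.2 (Fin.ne_zero_of_lt hij)
      rw [hsucc, if_neg]
      exact (ne_of_lt hij).symm
  rwa [Matrix.det_mul, hB, mul_one] at hdet

theorem det_one_sub_smul_regularMatrix (q : R) (t : G) {k : ℕ}
    (hk : Fintype.card G = orderOf t * k) :
    (1 - q • regularMatrix R t).det = (1 - q ^ orderOf t) ^ k := by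
  classical
  obtain ⟨N, hN⟩ : ∃ N, orderOf t = N + 1 := ⟨orderOf t - 1, by have := orderOf_pos t; omega⟩
  let z : Subgroup.zpowers t := ⟨t, Subgroup.mem_zpowers t⟩
  have hz : (1 - q • regularMatrix R z).det = 1 - q ^ orderOf t := by
    let e : Fin (N + 1) ≃ Subgroup.zpowers t :=
      (finCongr hN.symm).trans (finEquivZPowers (isOfFinOrder_of_finite t))
    have he : ∀ i, (e i : G) = t ^ (i : ℕ) := fun i => rfl
    have hmul : ∀ i, z * e i = e (i + 1) := by
      intro i
      apply Subtype.ext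
      rw [Subgroup.coe_mul, he, he, ← pow_succ', pow_inj_mod, hN, Fin.val_add]
      simp
    rw [hN, ← det_one_sub_cyclic, ← Matrix.det_submatrix_equiv_self e]
    congr 1
    ext i j
    simp [regularMatrix_apply, hmul, Matrix.one_apply]
  -- `1 - q • t` is the two-term combination with coefficients `1, -q`, supported on the cyclic
  -- subgroup.
  have key := det_sum_smul_regularMatrix_map (Subgroup.zpowers t).subtype
    (Subgroup.subtype_injective _) (k := k) (by rwa [Fintype.card_zpowers])
    (![1, -q] : Fin 2 → R) ![1, z]
  simp only [Fin.sum_univ_two, Matrix.cons_val_zero, Matrix.cons_val_one, map_one, one_smul,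
    neg_smul, ← sub_eq_add_neg] at key
  rw [hz] at key
  exact key

theorem det_sum_smul_regularMatrix_ringHom {S ι : Type*} [CommRing S] [Fintype ι] (f : R →+* S)
    (c : ι → R) (a : ι → G) :
    f (∑ i, c i • regularMatrix R (a i)).det = (∑ i, f (c i) • regularMatrix S (a i)).det := by
  rw [RingHom.map_det]
  congr 1
  ext g h
  rw [RingHom.mapMatrix_apply, Matrix.map_apply, sum_smul_regularMatrix_apply,
    sum_smul_regularMatrix_apply, map_sum]
  simp only [apply_ite f, map_zero]

theorem one_sub_X_pow_ne_zero {k : ℕ} (hk : k ≠ 0) : (1 - Polynomial.X ^ k : Polynomial ℤ) ≠ 0 := by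
  intro h
  simpa [hk] using congrArg (Polynomial.eval 0) h

/-- The geometric sum times `1 - q • t` is the scalar `1 - q ^ N`. As `1 - q ^ N` may be a zero
divisor in `R`, the cancellation takes place over `ℤ[X]`, before specializing to `q`. -/
theorem det_sum_pow_smul_regularMatrix_pow (q : R) (t : G) {N k : ℕ} (hN : orderOf t = N)
    (hk : Fintype.card G = N * k) :
    (∑ i : Fin N, q ^ (i : ℕ) • regularMatrix R (t ^ (i : ℕ))).det =
      (1 - q ^ N) ^ ((N - 1) * k) := by
  subst hN
  have hpos := orderOf_pos t
  have hX : (∑ i : Fin (orderOf t), (Polynomial.X : Polynomial ℤ) ^ (i : ℕ) •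
      regularMatrix (Polynomial ℤ) (t ^ (i : ℕ))).det =
      (1 - Polynomial.X ^ orderOf t) ^ ((orderOf t - 1) * k) := by
    have h1 : (1 - (Polynomial.X : Polynomial ℤ) • regularMatrix (Polynomial ℤ) t) *
        ∑ i : Fin (orderOf t), (Polynomial.X : Polynomial ℤ) ^ (i : ℕ) •
          regularMatrix (Polynomial ℤ) (t ^ (i : ℕ)) =
        (1 - Polynomial.X ^ orderOf t : Polynomial ℤ) • 1 := by
      have h2 : ∀ i : ℕ, (Polynomial.X : Polynomial ℤ) ^ i •
          regularMatrix (Polynomial ℤ) (t ^ i) =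
          ((Polynomial.X : Polynomial ℤ) • regularMatrix (Polynomial ℤ) t) ^ i := by
        intro i
        rw [map_pow, smul_pow]
      simp only [h2]
      rw [Fin.sum_univ_eq_sum_range (fun i => ((Polynomial.X : Polynomial ℤ) •
        regularMatrix (Polynomial ℤ) t) ^ i), mul_neg_geom_sum, ← h2, pow_orderOf_eq_one, map_one,
        sub_smul, one_smul]
    have h3 := congrArg Matrix.det h1
    rw [Matrix.det_mul, det_one_sub_smul_regularMatrix _ t hk, Matrix.det_smul, Matrix.det_one,
      mul_one, hk] at h3
    apply mul_left_cancel₀ (pow_ne_zero k (one_sub_X_pow_ne_zero hpos.ne'))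
    rw [h3, ← pow_add]
    congr 1
    obtain ⟨M, hM⟩ : ∃ M, orderOf t = M + 1 := ⟨orderOf t - 1, by omega⟩
    rw [hM]
    simp
    ring
  have h := congrArg (Polynomial.eval₂RingHom (Int.castRingHom R) q) hX
  rw [det_sum_smul_regularMatrix_ringHom] at h
  simpa [Polynomial.eval₂_pow] using h

theorem sum_smul_regularMatrix_mul {ι κ μ : Type*} [Fintype ι] [Fintype κ] [Fintype μ]
    (e : ι × κ ≃ μ) {c : ι → R} {d : κ → R} {f : μ → R} {a : ι → G} {b : κ → G} {g : μ → G}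
    (hf : ∀ i j, f (e (i, j)) = c i * d j) (hg : ∀ i j, g (e (i, j)) = a i * b j) :
    ∑ x, f x • regularMatrix R (g x) =
      (∑ i, c i • regularMatrix R (a i)) * ∑ j, d j • regularMatrix R (b j) := by
  rw [← e.sum_comp, Fintype.sum_prod_type, Finset.sum_mul_sum]
  simp only [hf, hg, map_mul, smul_mul_smul_comm]

end RegularMatrix

/-! ### The flag major index and rotation of letters. -/

namespace ColoredPerm

variable {n m : ℕ}

theorem card_eq (n m : ℕ) [NeZero m] : Fintype.card (ColoredPerm n m) = n ! * m ^ n := by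
  rw [Fintype.card_congr (equivProd n m)]
  simp [Fintype.card_perm]

theorem maj_eq_sum (g : ColoredPerm (n + 1) m) :
    g.maj = ∑ i : Fin n, if g.letter i.succ < g.letter i.castSucc then (i : ℕ) + 1 else 0 := by
  rw [maj, descents, Finset.sum_filter, Fin.sum_univ_castSucc, if_neg (by simp), add_zero]
  refine Finset.sum_congr rfl fun i _ => ?_
  refine if_congr ⟨fun ⟨_, h⟩ => h, fun h => ⟨by simp, h⟩⟩ (by simp) rfl

theorem maj_of_zero (g : ColoredPerm 0 m) : g.maj = 0 := by
  rw [maj, Finset.eq_empty_of_isEmpty g.descents, Finset.sum_empty]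

/-- The flag major index. -/
def fmaj (g : ColoredPerm n m) : ℕ := m * g.maj + g.col

/-- The number of colored letters that are larger than the `i`-th letter. -/
def level (g : ColoredPerm n m) (i : Fin n) : ℕ := (g.color i).val * n + (g.perm i).rev

theorem level_lt [NeZero m] (g : ColoredPerm n m) (i : Fin n) : g.level i < m * n := by
  have h1 := (g.color i).val_lt
  have h2 := (g.perm i).rev.isLt
  have h3 : ((g.color i).val + 1) * n ≤ m * n := Nat.mul_le_mul_right n h1
  rw [add_mul, one_mul] at h3
  unfold level
  omega

theorem level_lt_level_iff (g h : ColoredPerm n m) (i j : Fin n) :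
    g.level i < h.level j ↔ h.letter j < g.letter i := by
  have h1 := (g.perm i).rev.isLt
  have h2 := (h.perm j).rev.isLt
  rw [letter, letter, Prod.Lex.toLex_lt_toLex, OrderDual.toDual_lt_toDual, OrderDual.toDual_inj,
    ← Fin.rev_lt_rev, Fin.lt_def]
  unfold level
  rcases lt_trichotomy (g.color i).val (h.color j).val with hc | hc | hc
  · have h3 : ((g.color i).val + 1) * n ≤ (h.color j).val * n := Nat.mul_le_mul_right n hc
    rw [add_mul, one_mul] at h3
    exact iff_of_true (by omega) (Or.inl hc)
  · simp [hc]
  · have h3 : ((h.color j).val + 1) * n ≤ (g.color i).val * n := Nat.mul_le_mul_right n hc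
    rw [add_mul, one_mul] at h3
    exact iff_of_false (by omega) (by omega)

theorem level_injective [NeZero m] : Function.Injective (level : ColoredPerm n m → Fin n → ℕ) := by
  intro g h hgh
  have hl : ∀ i, h.letter i = g.letter i := by
    intro i
    have h1 := level_lt_level_iff g h i i
    have h2 := level_lt_level_iff h g i i
    rw [hgh, iff_false_left (lt_irrefl _), not_lt] at h1 h2
    exact le_antisymm h2 h1
  ext i
  · have h1 := congrArg (fun x => (ofLex x).2) (hl i)
    exact congrArg Fin.val h1.symm
  · have h1 := congrArg (fun x => OrderDual.ofDual (ofLex x).1) (hl i)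
    exact ZMod.val_injective m h1.symm

/-- The group element that sends each colored letter to the next smaller one, and the smallest
letter to the largest. -/
def rotate (n m : ℕ) : ColoredPerm (n + 1) m :=
  ⟨Equiv.subRight 1, fun v => if v = 0 then 1 else 0⟩

theorem level_rotate_mul [NeZero m] (g : ColoredPerm (n + 1) m) (i : Fin (n + 1)) :
    (rotate n m * g).level i = (g.level i + 1) % (m * (n + 1)) := by
  have hlt := (rotate n m * g).level_lt i
  have hperm : (rotate n m * g).perm i = g.perm i - 1 := rfl
  have hcolor : (rotate n m * g).color i = (if g.perm i = 0 then 1 else 0) + g.color i := rfl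
  -- Only the smallest value wraps around, to the largest value with one more bar; from color `m -
  -- 1` it returns to color `0`.
  by_cases hv : g.perm i = 0
  · rw [level, level, hperm, hcolor, hv, if_pos rfl]
    have h0 : (0 : Fin (n + 1)) - 1 = Fin.last n := by
      rw [sub_eq_iff_eq_add, Fin.last_add_one]
    rw [h0, Fin.rev_last, Fin.rev_zero, Fin.val_last, Fin.val_zero, add_zero, add_assoc,
      ← Nat.succ_mul, Nat.mul_mod_mul_right, add_comm 1]
    congr 1
    rw [ZMod.val_add, ZMod.val_one_eq_one_mod, Nat.add_mod_mod]
  · obtain ⟨v, hv'⟩ := Fin.exists_succ_eq.2 hv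
    have h1 : v.succ - 1 = v.castSucc := by
      rw [sub_eq_iff_eq_add, Fin.coeSucc_eq_succ]
    have h2 : (rotate n m * g).level i = g.level i + 1 := by
      rw [level, level, hperm, hcolor, if_neg hv, zero_add, ← hv', h1, add_assoc, Fin.rev_succ,
        Fin.rev_castSucc]
      simp
    rw [h2] at hlt ⊢
    rw [Nat.mod_eq_of_lt hlt]

theorem level_rotate_pow_mul [NeZero m] (k : ℕ) (g : ColoredPerm (n + 1) m) (i : Fin (n + 1)) :
    (rotate n m ^ k * g).level i = (g.level i + k) % (m * (n + 1)) := by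
  induction k with
  | zero => simp [Nat.mod_eq_of_lt (g.level_lt i)]
  | succ k ih => rw [pow_succ', mul_assoc, level_rotate_mul, ih, Nat.mod_add_mod, add_assoc]

theorem orderOf_rotate (n m : ℕ) [NeZero m] : orderOf (rotate n m) = m * (n + 1) := by
  refine Nat.dvd_antisymm (orderOf_dvd_of_pow_eq_one ?_) ?_
  · apply level_injective
    funext i
    rw [← mul_one (_ ^ _), level_rotate_pow_mul, Nat.add_mod_right, Nat.mod_eq_of_lt (level_lt _ _)]
  · have h := level_rotate_pow_mul (orderOf (rotate n m)) (1 : ColoredPerm (n + 1) m) (Fin.last n)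
    rw [pow_orderOf_eq_one, mul_one] at h
    have h0 : (1 : ColoredPerm (n + 1) m).level (Fin.last n) = 0 := by simp [level]
    rw [h0, zero_add] at h
    exact Nat.dvd_of_mod_eq_zero h.symm

theorem sum_mul_sub_succ (L : Fin (n + 1) → ℤ) :
    ∑ j : Fin n, ((j : ℤ) + 1) * (L j.castSucc - L j.succ) + (n + 1) * L (Fin.last n) =
      ∑ i, L i := by
  induction n with
  | zero => simp
  | succ n ih =>
    rw [Fin.sum_univ_castSucc, Fin.sum_univ_castSucc (f := L), ← ih fun i => L i.castSucc]
    simp only [Fin.val_castSucc, Fin.val_last, Fin.succ_last, Fin.succ_castSucc]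
    push_cast
    ring

/-- Abel summation of the levels yields `col` up to a constant. A descent is a negative difference
of consecutive levels, so reducing modulo `m * (n + 1)` adds the modulus exactly there, which yields
`maj`. -/
theorem succ_mul_fmaj [NeZero m] (g : ColoredPerm (n + 1) m) :
    ((n : ℤ) + 1) * g.fmaj + ∑ i : Fin (n + 1), (i : ℤ) =
      (n + 1) * g.level (Fin.last n) + ∑ j : Fin n, ((j : ℤ) + 1) *
        (((g.level j.castSucc : ℤ) - g.level j.succ) % (m * (n + 1) : ℕ)) := by
  have hlevel : ∑ i, (g.level i : ℤ) = (n + 1) * g.col + ∑ i : Fin (n + 1), (i : ℤ) := by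
    rw [← Equiv.sum_comp (g.perm.trans Fin.revPerm) fun i : Fin (n + 1) => (i : ℤ)]
    simp [level, col, Finset.sum_add_distrib, Finset.mul_sum, mul_comm]
  have hmod : ∀ j : Fin n, (((g.level j.castSucc : ℤ) - g.level j.succ) % (m * (n + 1) : ℕ)) =
      (g.level j.castSucc - g.level j.succ) +
        if g.letter j.succ < g.letter j.castSucc then ((m * (n + 1) : ℕ) : ℤ) else 0 := by
    intro j
    have h1 := g.level_lt j.castSucc
    have h2 := g.level_lt j.succ
    simp only [← level_lt_level_iff]
    split_ifs with h
    · rw [← Int.add_emod_right]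
      exact Int.emod_eq_of_lt (by omega) (by omega)
    · rw [add_zero]
      exact Int.emod_eq_of_lt (by omega) (by omega)
  have hmaj : ((m * (n + 1) : ℕ) : ℤ) * g.maj = ∑ j : Fin n, ((j : ℤ) + 1) *
      if g.letter j.succ < g.letter j.castSucc then ((m * (n + 1) : ℕ) : ℤ) else 0 := by
    rw [maj_eq_sum, Nat.cast_sum, Finset.mul_sum]
    refine Finset.sum_congr rfl fun j _ => ?_
    split_ifs
    · push_cast
      ring
    · simp
  simp_rw [hmod, mul_add _ (_ - _ : ℤ), Finset.sum_add_distrib]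
  rw [← hmaj]
  have h := sum_mul_sub_succ fun i => (g.level i : ℤ)
  rw [hlevel] at h
  simp only [fmaj]
  push_cast at h ⊢
  linear_combination -h

/-- Rotation shifts all levels cyclically, so in `succ_mul_fmaj` only the term of the last level
changes. -/
theorem fmaj_rotate_pow_mul [NeZero m] (k : ℕ) (g : ColoredPerm (n + 1) m) :
    (rotate n m ^ k * g).fmaj + g.level (Fin.last n) =
      g.fmaj + (rotate n m ^ k * g).level (Fin.last n) := by
  have h1 := succ_mul_fmaj g
  have h2 := succ_mul_fmaj (rotate n m ^ k * g)
  have h3 : ∀ j : Fin n, (((rotate n m ^ k * g).level j.castSucc : ℤ) -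
      (rotate n m ^ k * g).level j.succ) % (m * (n + 1) : ℕ) =
      ((g.level j.castSucc : ℤ) - g.level j.succ) % (m * (n + 1) : ℕ) := by
    intro j
    rw [level_rotate_pow_mul, level_rotate_pow_mul, Int.natCast_mod, Int.natCast_mod,
      ← Int.sub_emod]
    congr 1
    push_cast
    ring
  simp only [h3] at h2
  have h4 : ((n : ℤ) + 1) * ((rotate n m ^ k * g).fmaj + g.level (Fin.last n)) =
      (n + 1) * (g.fmaj + (rotate n m ^ k * g).level (Fin.last n)) := by
    linear_combination h2 - h1
  exact_mod_cast mul_left_cancel₀ (by positivity) h4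

/-- The colored permutations of `n` letters, as those of `n + 1` letters that fix the last one. -/
def extend (n m : ℕ) : ColoredPerm n m →* ColoredPerm (n + 1) m where
  toFun g :=
    { perm :=
        { toFun := Fin.lastCases (motive := fun _ => Fin (n + 1)) (Fin.last n)
            fun i => (g.perm i).castSucc
          invFun := Fin.lastCases (motive := fun _ => Fin (n + 1)) (Fin.last n)
            fun i => (g.perm⁻¹ i).castSucc
          left_inv := fun i => by cases i using Fin.lastCases <;> simp
          right_inv := fun i => by cases i using Fin.lastCases <;> simp }
      color := Fin.lastCases (motive := fun _ => ZMod m) 0 g.color }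
  map_one' := by
    ext i <;> cases i using Fin.lastCases <;> simp
  map_mul' g h := by
    ext i <;> cases i using Fin.lastCases <;> simp

@[simp] theorem extend_perm_castSucc (g : ColoredPerm n m) (i : Fin n) :
    (extend n m g).perm i.castSucc = (g.perm i).castSucc := by
  simp [extend]

@[simp] theorem extend_perm_last (g : ColoredPerm n m) :
    (extend n m g).perm (Fin.last n) = Fin.last n := by
  simp [extend]

@[simp] theorem extend_color_castSucc (g : ColoredPerm n m) (i : Fin n) :
    (extend n m g).color i.castSucc = g.color i := by
  simp [extend]

@[simp] theorem extend_color_last (g : ColoredPerm n m) :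
    (extend n m g).color (Fin.last n) = 0 := by
  simp [extend]

theorem extend_injective : Function.Injective (extend n m) := by
  intro g h hgh
  ext i
  · simpa using congrArg (fun x => ((x.perm i.castSucc : Fin (n + 1)) : ℕ)) hgh
  · simpa using congrArg (fun x => x.color i.castSucc) hgh

theorem level_extend_last (g : ColoredPerm n m) : (extend n m g).level (Fin.last n) = 0 := by
  simp [level]

theorem maj_extend [NeZero m] (g : ColoredPerm n m) : (extend n m g).maj = g.maj := by
  cases n with
  | zero => simp [maj_eq_sum, maj_of_zero]
  | succ n =>
    rw [maj_eq_sum, Fin.sum_univ_castSucc, maj_eq_sum, if_neg, add_zero]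
    · refine Finset.sum_congr rfl fun i _ => ?_
      simp only [letter, Prod.Lex.toLex_lt_toLex, Fin.succ_castSucc, extend_color_castSucc,
        extend_perm_castSucc, Fin.castSucc_lt_castSucc_iff, Fin.val_castSucc]
    -- The appended letter is the largest of all, so no descent precedes it.
    · rw [← level_lt_level_iff, Fin.succ_last, level_extend_last]
      exact Nat.not_lt_zero _

theorem fmaj_extend [NeZero m] (g : ColoredPerm n m) : (extend n m g).fmaj = g.fmaj := by
  simp [fmaj, maj_extend, col, Fin.sum_univ_castSucc]

theorem level_rotate_pow_mul_extend [NeZero m] (k : Fin (m * (n + 1))) (g : ColoredPerm n m) :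
    (rotate n m ^ (k : ℕ) * extend n m g).level (Fin.last n) = k := by
  rw [level_rotate_pow_mul, level_extend_last, zero_add, Nat.mod_eq_of_lt k.isLt]

/-- The factorization of a colored permutation into a power of `rotate` and a colored permutation
that fixes the last letter. -/
noncomputable def rotateExtendEquiv (n m : ℕ) [NeZero m] :
    Fin (m * (n + 1)) × ColoredPerm n m ≃ ColoredPerm (n + 1) m :=
  Equiv.ofBijective (fun x => rotate n m ^ (x.1 : ℕ) * extend n m x.2) <| by
    rw [Fintype.bijective_iff_injective_and_card]
    constructor
    · rintro ⟨k, g⟩ ⟨l, h⟩ hgh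
      have hgh' : rotate n m ^ (k : ℕ) * extend n m g = rotate n m ^ (l : ℕ) * extend n m h := hgh
      -- The exponent of the rotation is read off as the level of the last letter.
      have hkl : k = l := by
        apply Fin.ext
        rw [← level_rotate_pow_mul_extend k g, hgh', level_rotate_pow_mul_extend]
      subst hkl
      rw [extend_injective (mul_left_cancel hgh')]
    · rw [Fintype.card_prod, Fintype.card_fin, card_eq, card_eq, Nat.factorial_succ]
      ring

theorem fmaj_rotateExtendEquiv [NeZero m] (k : Fin (m * (n + 1))) (g : ColoredPerm n m) :
    (rotateExtendEquiv n m (k, g)).fmaj = k + g.fmaj := by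
  have h := fmaj_rotate_pow_mul (k : ℕ) (extend n m g)
  rw [level_extend_last, level_rotate_pow_mul_extend, fmaj_extend, add_zero,
    add_comm g.fmaj] at h
  exact h

/-! ### The determinant for the flag major index. -/

variable {R : Type*} [CommRing R]

theorem det_fmaj_succ [NeZero m] (q : R) :
    (∑ g : ColoredPerm (n + 1) m, q ^ g.fmaj • regularMatrix R g).det =
      (1 - q ^ (m * (n + 1))) ^ ((m * (n + 1) - 1) * (n ! * m ^ n)) *
        (∑ g : ColoredPerm n m, q ^ g.fmaj • regularMatrix R g).det ^ (m * (n + 1)) := by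
  have hcard : Fintype.card (ColoredPerm (n + 1) m) = m * (n + 1) * (n ! * m ^ n) := by
    rw [card_eq, Nat.factorial_succ]
    ring
  rw [sum_smul_regularMatrix_mul (rotateExtendEquiv n m)
    (c := fun k : Fin (m * (n + 1)) => q ^ (k : ℕ)) (d := fun g => q ^ g.fmaj)
    (a := fun k => rotate n m ^ (k : ℕ)) (b := fun g => extend n m g)
    (fun k g => by rw [fmaj_rotateExtendEquiv, pow_add]) (fun _ _ => rfl),
    Matrix.det_mul, det_sum_pow_smul_regularMatrix_pow q _ (orderOf_rotate n m) hcard,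
    det_sum_smul_regularMatrix_map (extend n m) extend_injective (k := m * (n + 1))]
  rw [hcard, card_eq, mul_comm]

theorem mul_dvd_factorial_mul_pow {k : ℕ} (hk : k ∈ Finset.Icc 1 n) : m * k ∣ n ! * m ^ n := by
  rw [Finset.mem_Icc] at hk
  rw [mul_comm]
  exact mul_dvd_mul (Nat.dvd_factorial hk.1 hk.2) (dvd_pow_self m (by omega))

theorem det_fmaj [NeZero m] (n : ℕ) (q : R) :
    (∑ g : ColoredPerm n m, q ^ g.fmaj • regularMatrix R g).det =
      ∏ k ∈ Finset.Icc 1 n, (1 - q ^ (m * k)) ^ ((m * k - 1) * (n ! * m ^ n / (m * k))) := by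
  induction n with
  | zero =>
    have h : ∑ g : ColoredPerm 0 m, q ^ g.fmaj • regularMatrix R g = 1 := by
      have : Subsingleton (ColoredPerm 0 m) := (equivProd 0 m).subsingleton
      rw [Fintype.sum_subsingleton _ 1]
      simp [fmaj, maj_of_zero, col]
    simp [h]
  | succ n ih =>
    rw [det_fmaj_succ, ih, Finset.prod_Icc_succ_top (by omega), mul_comm]
    have hm := NeZero.pos m
    have hfac : (n + 1)! * m ^ (n + 1) = n ! * m ^ n * (m * (n + 1)) := by
      rw [Nat.factorial_succ]
      ring
    rw [hfac, Nat.mul_div_cancel _ (by positivity), ← Finset.prod_pow]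
    congr 1
    refine Finset.prod_congr rfl fun k hk => ?_
    rw [← pow_mul, mul_assoc, Nat.div_mul_right_comm (mul_dvd_factorial_mul_pow hk)]

end ColoredPerm

/-! ### Sorting, and separation of `maj` from `col`. -/

namespace ColoredPerm

variable {n m : ℕ}

theorem letter_injective (g : ColoredPerm n m) : Function.Injective g.letter := by
  intro i j hij
  exact g.perm.injective (congrArg (fun x => (ofLex x).2) hij)

/-- Uncolored permutations, as the colored permutations all of whose colors are zero. -/
def ofUncolored (n m : ℕ) : ColoredPerm n 1 →* ColoredPerm n m where
  toFun g := ⟨g.perm, 0⟩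
  map_one' := by ext <;> simp
  map_mul' g h := by ext <;> simp

@[simp] theorem ofUncolored_perm (g : ColoredPerm n 1) : (ofUncolored n m g).perm = g.perm := rfl

@[simp] theorem ofUncolored_color (g : ColoredPerm n 1) : (ofUncolored n m g).color = 0 := rfl

theorem ext_perm {g h : ColoredPerm n 1} (hgh : g.perm = h.perm) : g = h :=
  ColoredPerm.ext hgh (Subsingleton.elim _ _)

theorem ofUncolored_injective : Function.Injective (ofUncolored n m) := fun _ _ hgh =>
  ext_perm (congrArg (fun x : ColoredPerm n m => x.perm) hgh)

theorem letter_mul_ofUncolored (s : ColoredPerm n m) (u : ColoredPerm n 1) (i : Fin n) :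
    (s * ofUncolored n m u).letter i = s.letter (u.perm i) := by
  simp [letter]

theorem letter_lt_letter_iff_perm (u : ColoredPerm n 1) (i j : Fin n) :
    u.letter i < u.letter j ↔ u.perm i < u.perm j := by
  simp [letter, Prod.Lex.toLex_lt_toLex, Subsingleton.elim (u.color i) 0,
    Subsingleton.elim (u.color j) 0]

theorem maj_mul_ofUncolored {s : ColoredPerm n m} (hs : StrictMono s.letter)
    (u : ColoredPerm n 1) : (s * ofUncolored n m u).maj = u.maj := by
  unfold maj
  congr 1
  ext i
  simp [descents, letter_mul_ofUncolored, hs.lt_iff_lt, letter_lt_letter_iff_perm]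

theorem col_mul_ofUncolored (s : ColoredPerm n m) (u : ColoredPerm n 1) :
    (s * ofUncolored n m u).col = s.col := by
  simp only [col, mul_color, ofUncolored_color, Pi.zero_apply, add_zero, ofUncolored_perm]
  exact Equiv.sum_comp u.perm fun i => (s.color i).val

theorem fmaj_uncolored (u : ColoredPerm n 1) : u.fmaj = u.maj := by
  simp [fmaj, col, Subsingleton.elim u.color 0]

/-- The factorization of a colored permutation into its increasing rearrangement and an uncolored
permutation. -/
noncomputable def sortEquiv (n m : ℕ) :
    {s : ColoredPerm n m // StrictMono s.letter} × ColoredPerm n 1 ≃ ColoredPerm n m :=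
  Equiv.ofBijective (fun x => x.1 * ofUncolored n m x.2) <| by
    have hsort : ∀ (s : ColoredPerm n m) (u : ColoredPerm n 1),
        (s * ofUncolored n m u).letter ∘ (u.perm⁻¹ : Equiv.Perm (Fin n)) = s.letter := by
      intro s u
      funext i
      simp [letter_mul_ofUncolored]
    constructor
    · rintro ⟨⟨s, hs⟩, u⟩ ⟨⟨t, ht⟩, v⟩ h
      have h' : s * ofUncolored n m u = t * ofUncolored n m v := h
      have hu := hsort s u
      have hv := hsort t v
      rw [← h'] at hv
      -- Both `u⁻¹` and `v⁻¹` sort the same word of distinct letters.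
      have huv := Tuple.unique_monotone (hu ▸ hs.monotone) (hv ▸ ht.monotone)
      have hinv : u.perm⁻¹ = v.perm⁻¹ :=
        Equiv.ext fun i => letter_injective _ (congrFun huv i)
      obtain rfl := ext_perm (inv_injective hinv)
      obtain rfl := mul_right_cancel h'
      rfl
    · intro g
      let u : ColoredPerm n 1 := ⟨Tuple.sort g.letter, 0⟩
      have hs : (g * ofUncolored n m u).letter = g.letter ∘ Tuple.sort g.letter :=
        funext fun i => letter_mul_ofUncolored g u i
      refine ⟨(⟨g * ofUncolored n m u, ?_⟩, u⁻¹), ?_⟩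
      · refine Monotone.strictMono_of_injective ?_ (letter_injective _)
        rw [hs]
        exact Tuple.monotone_sort _
      · simp [mul_assoc]

variable {R : Type*} [CommRing R]

/-- This is `det_fmaj` for `m = 1`, carried to a subgroup of index `m ^ n`. -/
theorem det_maj_uncolored [NeZero m] (n : ℕ) (p : R) :
    (∑ u : ColoredPerm n 1, p ^ u.maj • regularMatrix R (ofUncolored n m u)).det =
      ∏ k ∈ Finset.Icc 1 n, (1 - p ^ k) ^ ((k - 1) * (n ! / k) * m ^ n) := by
  rw [det_sum_smul_regularMatrix_map (ofUncolored n m) ofUncolored_injective (k := m ^ n)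
    (by simp [card_eq])]
  simp_rw [← fmaj_uncolored]
  simp [det_fmaj, ← Finset.prod_pow, pow_mul]

open scoped Classical in
theorem sum_maj_col_eq_mul [NeZero m] (n : ℕ) (p q : R) :
    ∑ g : ColoredPerm n m, (p ^ g.maj * q ^ g.col) • regularMatrix R g =
      (∑ s : {s : ColoredPerm n m // StrictMono s.letter},
        q ^ s.1.col • regularMatrix R s.1) *
      ∑ u : ColoredPerm n 1, p ^ u.maj • regularMatrix R (ofUncolored n m u) := by
  refine sum_smul_regularMatrix_mul (sortEquiv n m) (fun s u => ?_) fun s u => rfl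
  have h : sortEquiv n m (s, u) = s.1 * ofUncolored n m u := rfl
  rw [h, maj_mul_ofUncolored s.2, col_mul_ofUncolored, mul_comm]

open scoped Classical in
theorem det_col_increasing [NeZero m] (n : ℕ) (q : R) :
    (∑ s : {s : ColoredPerm n m // StrictMono s.letter}, q ^ s.1.col • regularMatrix R s.1).det =
      ∏ k ∈ Finset.Icc 1 n, (1 - q ^ (m * k)) ^ (n ! * m ^ (n - 1) * (m - 1) / k) := by
  have hm := NeZero.pos m
  have hX : (∑ s : {s : ColoredPerm n m // StrictMono s.letter},
      (Polynomial.X : Polynomial ℤ) ^ s.1.col • regularMatrix (Polynomial ℤ) s.1).det =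
      ∏ k ∈ Finset.Icc 1 n,
        (1 - Polynomial.X ^ (m * k)) ^ (n ! * m ^ (n - 1) * (m - 1) / k) := by
    -- At `p = X ^ m` the weight `p ^ maj * X ^ col` becomes `X ^ fmaj`.
    have h := congrArg Matrix.det
      (sum_maj_col_eq_mul n (Polynomial.X ^ m : Polynomial ℤ) Polynomial.X (m := m))
    rw [Matrix.det_mul, det_maj_uncolored] at h
    simp_rw [← pow_mul, ← pow_add] at h
    refine mul_right_cancel₀ (Finset.prod_ne_zero_iff.2 fun k hk => ?_)
      (h.symm.trans ((det_fmaj n _).trans ?_))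
    · rw [Finset.mem_Icc] at hk
      exact pow_ne_zero _ (one_sub_X_pow_ne_zero (mul_pos hm hk.1).ne')
    · rw [← Finset.prod_mul_distrib]
      refine Finset.prod_congr rfl fun k hk => ?_
      rw [Finset.mem_Icc] at hk
      rw [← pow_add]
      congr 1
      -- With `c = n ! / k`, the exponents agree because `m * k - 1 = (m - 1) + m * (k - 1)`.
      obtain ⟨c, hc⟩ := Nat.dvd_factorial hk.1 hk.2
      obtain ⟨l, rfl⟩ : ∃ l, m = l + 1 := ⟨m - 1, by omega⟩
      obtain ⟨j, rfl⟩ : ∃ j, k = j + 1 := ⟨k - 1, by omega⟩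
      obtain ⟨N, rfl⟩ : ∃ N, n = N + 1 := ⟨n - 1, by omega⟩
      have h1 : (N + 1)! * (l + 1) ^ (N + 1) / ((l + 1) * (j + 1)) = c * (l + 1) ^ N := by
        rw [hc]
        exact Nat.div_eq_of_eq_mul_right (by positivity) (by ring)
      have h2 : (N + 1)! * (l + 1) ^ (N + 1 - 1) * (l + 1 - 1) / (j + 1) =
          c * (l + 1) ^ N * l := by
        rw [hc]
        exact Nat.div_eq_of_eq_mul_right (by positivity) (by simp; ring)
      have h3 : (N + 1)! / (j + 1) = c := by
        rw [hc]
        exact Nat.mul_div_cancel_left _ (by positivity)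
      have h4 : (l + 1) * (j + 1) - 1 = l * (j + 1) + j := by
        rw [add_mul, one_mul]
        omega
      rw [h1, h2, h3, h4, Nat.add_sub_cancel]
      ring
  have h := congrArg (Polynomial.eval₂RingHom (Int.castRingHom R) q) hX
  rw [det_sum_smul_regularMatrix_ringHom] at h
  simpa [Polynomial.eval₂_pow, Polynomial.eval₂_finsetProd] using h

end ColoredPerm

/-- The divisions in the exponents are exact, as `k ∣ n !` for `1 ≤ k ≤ n`. -/
theorem mainTheorem5 {R : Type*} [CommRing R] (p q : R) (m n : ℕ) [NeZero m] (hn : 1 ≤ n) :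
    (Matrix.of fun g h : ColoredPerm n m =>
        p ^ (g * h⁻¹).maj * q ^ (g * h⁻¹).col).det =
      (∏ k ∈ Finset.Icc 2 n, (1 - p ^ k) ^ (n ! * m ^ n * (k - 1) / k)) *
        ∏ k ∈ Finset.Icc 1 n, (1 - q ^ (m * k)) ^ (n ! * m ^ (n - 1) * (m - 1) / k) := by
  rw [of_mul_inv_eq_sum_smul_regularMatrix fun g : ColoredPerm n m => p ^ g.maj * q ^ g.col,
    ColoredPerm.sum_maj_col_eq_mul, Matrix.det_mul, ColoredPerm.det_col_increasing,
    ColoredPerm.det_maj_uncolored, mul_comm]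
  congr 1
  -- The factor at `k = 1` has exponent `0`.
  rw [← Finset.prod_subset (Finset.Icc_subset_Icc_left one_le_two) (s₁ := Finset.Icc 2 n)]
  · refine Finset.prod_congr rfl fun k hk => ?_
    rw [Finset.mem_Icc] at hk
    congr 1
    obtain ⟨c, hc⟩ := Nat.dvd_factorial (by omega : 0 < k) hk.2
    rw [hc, Nat.mul_div_cancel_left _ (by omega)]
    exact (Nat.div_eq_of_eq_mul_right (by omega) (by ring)).symm
  · intro k hk hk'
    have : k = 1 := by
      rw [Finset.mem_Icc] at hk hk'
      omega
    simp [this]
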